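/- Let the Bernoulli polynomials of the second kind $b_n(x)$ be defined by the generating function $$\sum_{n=0}^{\infty}\frac{b_n(x)}{n!}t^n=\frac{t(1+t)^x}{\ln(1+t)},$$ and let $b_n:=b_n(0)$ be the $n$-th Bernoulli number of the second kind. Then for every integer $n\ge 2$, $$b_n=(-1)^{n-1}\frac{1}{(n+1)!}\sum_{k=0}^{n-2}\ \sum_{1=i_0<i_1<\cdots<i_{k+1}=n}\ \prod_{j=0}^{k}\bigl((i_{j+1}-i_j-1)!\bigr)^2\binom{i_{j+1}}{i_j+1}\binom{i_{j+1}}{i_j-1},$$ where the inner sum is over all integer sequences $i_0<i_1<\cdots<i_{k+1}$ with $i_0=1$ and $i_{k+1}=n$. -/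

import Mathlib

open scoped Nat

noncomputable section

namespace BernoulliSecondKind

/-- The formal power series `ln(1+t)/t = 1 - t/2 + t²/3 - ⋯` over `ℚ`. -/
def logDivT : PowerSeries ℚ :=
  PowerSeries.mk fun n => PowerSeries.coeff (n + 1) (PowerSeries.log ℚ)

theorem t_mul_logDivT : PowerSeries.X * logDivT = PowerSeries.log ℚ := by
  ext n
  cases n with
  | zero => simp
  | succ n => simp only [PowerSeries.coeff_succ_X_mul, logDivT, PowerSeries.coeff_mk]

theorem constantCoeff_logDivT : PowerSeries.constantCoeff logDivT = 1 := by
  rw [← PowerSeries.coeff_zero_eq_constantCoeff_apply]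
  simp [logDivT]

/-- The formal power series `t(1+t)^x / ln(1+t)` in `t`, with coefficients in the polynomial
ring `ℚ[x]`; here `(1+t)^x = ∑ binom(x, n) t^n`. -/
def genFun : PowerSeries (Polynomial ℚ) :=
  PowerSeries.binomialSeries (Polynomial ℚ) (Polynomial.X : Polynomial ℚ) *
    PowerSeries.map Polynomial.C logDivT⁻¹

/-- The `n`-th Bernoulli polynomial of the second kind `b_n(x)`, determined by
`∑ (b_n(x)/n!) t^n = t(1+t)^x / ln(1+t)`. -/
def bernoulliPoly (n : ℕ) : Polynomial ℚ :=
  Polynomial.C (n ! : ℚ) * PowerSeries.coeff n genFun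

/-- The `n`-th Bernoulli number of the second kind `b_n = b_n(0)`. -/
def bernoulliNumber (n : ℕ) : ℚ :=
  (bernoulliPoly n).eval 0

/-- The defining generating function, with the denominator `ln(1+t)` cleared. -/
theorem bernoulliPoly_genFun :
    PowerSeries.mk (fun n => Polynomial.C ((n ! : ℚ)⁻¹) * bernoulliPoly n) *
        PowerSeries.log (Polynomial ℚ) =
      PowerSeries.X *
        PowerSeries.binomialSeries (Polynomial ℚ) (Polynomial.X : Polynomial ℚ) := by
  have h1 : PowerSeries.mk (fun n => Polynomial.C ((n ! : ℚ)⁻¹) * bernoulliPoly n) = genFun := by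
    ext1 n
    have hn : (n ! : ℚ) ≠ 0 := by exact_mod_cast n.factorial_ne_zero
    rw [PowerSeries.coeff_mk, bernoulliPoly, ← mul_assoc, ← Polynomial.C_mul,
      inv_mul_cancel₀ hn, Polynomial.C_1, one_mul]
  have h2 : PowerSeries.log (Polynomial ℚ) =
      PowerSeries.X * PowerSeries.map Polynomial.C logDivT := by
    rw [← PowerSeries.map_log (Polynomial.C : ℚ →+* Polynomial ℚ), ← t_mul_logDivT, map_mul,
      PowerSeries.map_X]
  have h3 : PowerSeries.map (Polynomial.C : ℚ →+* Polynomial ℚ) logDivT⁻¹ *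
      PowerSeries.map Polynomial.C logDivT = 1 := by
    rw [← map_mul, PowerSeries.inv_mul_cancel _ (by rw [constantCoeff_logDivT]; exact one_ne_zero),
      map_one]
  rw [h1, h2, genFun]
  linear_combination (PowerSeries.X *
    PowerSeries.binomialSeries (Polynomial ℚ) (Polynomial.X : Polynomial ℚ)) * h3

open Classical in
/-- The integer sequences `1 = i_0 < i_1 < ⋯ < i_{k+1} = n`. -/
def chains (n k : ℕ) : Finset (Fin (k + 2) → ℕ) :=
  {i ∈ Fintype.piFinset (fun _ : Fin (k + 2) => Finset.Icc 1 n) |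
    StrictMono i ∧ i 0 = 1 ∧ i (Fin.last (k + 1)) = n}

/-- The restriction to the box `[1, n]` in the definition of `chains` is only there to make the
set visibly finite. -/
theorem mem_chains {n k : ℕ} {i : Fin (k + 2) → ℕ} :
    i ∈ chains n k ↔ StrictMono i ∧ i 0 = 1 ∧ i (Fin.last (k + 1)) = n := by
  classical
  simp only [chains, Finset.mem_filter, Fintype.mem_piFinset, Finset.mem_Icc]
  refine ⟨fun h => h.2, fun h => ⟨fun a => ?_, h⟩⟩
  obtain ⟨hm, h0, hl⟩ := h
  exact ⟨h0 ▸ hm.monotone (Fin.zero_le a), hl ▸ hm.monotone (Fin.le_last a)⟩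

end BernoulliSecondKind

end

/-!
Write `f = t / ln(1+t) = ∑ cₙ tⁿ`, so that `bₙ = n! cₙ`. Differentiating `f · ln(1+t) = t` gives
`t f' · ((1+t) ln(1+t) / t) = (1+t) - f` (`X_mul_derivative_inv_logDivT`), and the second factor on
the left has coefficients `1` in degree `0` and `(-1)^(k-1) / (k(k+1))` in degree `k ≥ 1`. Comparing
coefficients expresses `(n+1) cₙ` through `c₁, …, cₙ₋₁` (`coeff_inv_logDivT_recurrence`). After the
normalization `Aₙ = (-1)^(n-1) (n+1)! bₙ` the recurrence becomes `A₁ = 1` and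
`Aₙ = ∑_{1 ≤ m < n} Aₘ w(m, n)` for `n ≥ 2`, where
`w(m, n) = ((n-m-1)!)² binom(n, m+1) binom(n, m-1)` (`normalizedNumber_recurrence`).

Unfolding any recurrence of this shape expresses `Aₙ` as the sum over all chains
`1 = i₀ < ⋯ < i_{k+1} = n` of the products `∏ w(i_j, i_{j+1})` (`sum_chainSum_eq`): a chain with at
least two steps is a chain ending at some `m < n` followed by the step from `m` to `n`
(`chainSum_succ`).
-/

noncomputable section

namespace BernoulliSecondKind

/-! ### Sums over chains -/

/-- The sum over the chains `1 = i₀ < ⋯ < i_{k+1} = n` of the product of the weights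
`w i_j i_{j+1}` of their steps. -/
def chainSum (w : ℕ → ℕ → ℚ) (n k : ℕ) : ℚ :=
  ∑ i ∈ chains n k, ∏ j : Fin (k + 1), w (i j.castSucc) (i j.succ)

theorem chainSum_zero (w : ℕ → ℕ → ℚ) {n : ℕ} (hn : 2 ≤ n) : chainSum w n 0 = w 1 n := by
  have h : chains n 0 = {![1, n]} := by
    ext i
    rw [mem_chains, Finset.mem_singleton]
    constructor
    · rintro ⟨-, h0, h1⟩
      ext j
      fin_cases j
      · exact h0
      · exact h1
    · rintro rfl
      refine ⟨?_, rfl, rfl⟩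
      rw [Fin.strictMono_iff_lt_succ]
      intro j
      fin_cases j
      exact hn
  simp [chainSum, h]

theorem snoc_mem_chains {m n k : ℕ} (hmn : m < n) {i : Fin (k + 2) → ℕ} (hi : i ∈ chains m k) :
    (Fin.snoc i n : Fin (k + 3) → ℕ) ∈ chains n (k + 1) := by
  obtain ⟨hm, h0, hl⟩ := mem_chains.1 hi
  refine mem_chains.2 ⟨?_, ?_, Fin.snoc_last (α := fun _ => ℕ) n i⟩
  · rw [Fin.strictMono_iff_lt_succ]
    intro j
    cases j using Fin.lastCases with
    | last => simpa [Fin.succ_last, hl] using hmn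
    | cast j =>
      rw [Fin.succ_castSucc, Fin.snoc_castSucc (α := fun _ => ℕ),
        Fin.snoc_castSucc (α := fun _ => ℕ)]
      exact hm j.castSucc_lt_succ
  · exact (Fin.snoc_castSucc (α := fun _ => ℕ) n i 0).trans h0

theorem init_mem_chains {n k : ℕ} {i : Fin (k + 3) → ℕ} (hi : i ∈ chains n (k + 1)) :
    (Fin.init i : Fin (k + 2) → ℕ) ∈ chains (i (Fin.last (k + 1)).castSucc) k := by
  obtain ⟨hm, h0, -⟩ := mem_chains.1 hi
  exact mem_chains.2 ⟨fun a b hab => hm (Fin.castSucc_lt_castSucc_iff.2 hab), h0, rfl⟩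

/-- Splitting off the last step of a chain. -/
theorem chainSum_succ (w : ℕ → ℕ → ℚ) (n k : ℕ) :
    chainSum w n (k + 1) = ∑ m ∈ Finset.Ico 2 n, chainSum w m k * w m n := by
  simp only [chainSum, Finset.sum_mul]
  rw [Finset.sum_sigma']
  refine Finset.sum_bij' (fun i _ => ⟨i (Fin.last (k + 1)).castSucc, Fin.init i⟩)
    (fun p _ => Fin.snoc p.2 n) ?_ ?_ ?_ ?_ ?_
  · intro i hi
    refine Finset.mem_sigma.2 ⟨Finset.mem_Ico.2 ⟨?_, ?_⟩, init_mem_chains hi⟩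
    · obtain ⟨hm, h0, -⟩ := mem_chains.1 hi
      have : i 0 < i (Fin.last (k + 1)).castSucc := hm (by simp [Fin.lt_def])
      simp only
      omega
    · obtain ⟨hm, -, hl⟩ := mem_chains.1 hi
      simpa [hl] using hm (Fin.castSucc_lt_last (Fin.last (k + 1)))
  · rintro ⟨m, i⟩ hp
    obtain ⟨h1, h2⟩ := Finset.mem_sigma.1 hp
    exact snoc_mem_chains (Finset.mem_Ico.1 h1).2 h2
  · intro i hi
    obtain ⟨-, -, hl⟩ := mem_chains.1 hi
    simp only [← hl]
    exact Fin.snoc_init_self i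
  · rintro ⟨m, i⟩ hp
    obtain ⟨-, h2⟩ := Finset.mem_sigma.1 hp
    obtain ⟨-, -, hl⟩ := mem_chains.1 h2
    simp only [Fin.snoc_castSucc (α := fun _ => ℕ), Fin.init_snoc (α := fun _ => ℕ)]
    exact congrArg (fun m => (⟨m, i⟩ : (_ : ℕ) × (Fin (k + 2) → ℕ))) hl
  · intro i hi
    obtain ⟨-, -, hl⟩ := mem_chains.1 hi
    rw [Fin.prod_univ_castSucc, Fin.succ_last, hl]
    rfl

/-- A sequence satisfying a recurrence with weights `w` is the sum over all chains. Any bound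
`N ≥ n - 1` on the number of steps will do, longer chains being empty; this freedom is what makes
the induction go through. -/
theorem sum_chainSum_eq {w : ℕ → ℕ → ℚ} {A : ℕ → ℚ} (h1 : A 1 = 1)
    (h : ∀ n, 2 ≤ n → A n = ∑ m ∈ Finset.Ico 1 n, A m * w m n) (N : ℕ) :
    ∀ n, 2 ≤ n → n ≤ N + 1 → ∑ k ∈ Finset.range N, chainSum w n k = A n := by
  induction N with
  | zero => intro n h2 hN; omega
  | succ N ih =>
    intro n h2 hN
    rw [Finset.sum_range_succ', chainSum_zero w h2, h n h2,
      Finset.sum_eq_sum_Ico_succ_bot (by omega : 1 < n), h1, one_mul, add_comm]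
    simp only [chainSum_succ]
    rw [Finset.sum_comm]
    congr 1
    refine Finset.sum_congr rfl fun m hm => ?_
    rw [Finset.mem_Ico] at hm
    rw [← Finset.sum_mul, ih m hm.1 (by omega)]

/-! ### The differential equation of `t / ln(1+t)` -/

open PowerSeries

theorem coeff_logDivT (n : ℕ) : coeff n logDivT = (-1 : ℚ) ^ n / (n + 1) := by
  simp [logDivT, pow_add]

theorem one_add_X_mul_derivative_log : (1 + X) * d⁄dX ℚ (log ℚ) = 1 := by
  rw [deriv_log]
  ext n
  cases n with
  | zero => simp [add_mul]
  | succ n => simp [add_mul, coeff_succ_X_mul, pow_succ, coeff_one]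

/-- The differential equation `t f' · ((1+t) ln(1+t) / t) = (1+t) - f` of `f = t / ln(1+t)`. -/
theorem X_mul_derivative_inv_logDivT :
    X * d⁄dX ℚ logDivT⁻¹ * ((1 + X) * logDivT) = (1 + X) - logDivT⁻¹ := by
  have hinv : logDivT⁻¹ * logDivT = 1 :=
    PowerSeries.inv_mul_cancel _ (by rw [constantCoeff_logDivT]; exact one_ne_zero)
  have hlog := one_add_X_mul_derivative_log
  rw [← t_mul_logDivT, Derivation.leibniz, derivative_X] at hlog
  simp only [smul_eq_mul, mul_one] at hlog
  rw [derivative_inv']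
  linear_combination (-logDivT⁻¹ ^ 2 * logDivT) * hlog +
    ((1 + X) * (logDivT⁻¹ * logDivT + 1) - logDivT⁻¹) * hinv

theorem coeff_succ_one_add_X_mul_logDivT (k : ℕ) :
    coeff (k + 1) ((1 + X) * logDivT) = (-1 : ℚ) ^ k / ((k + 1) * (k + 2)) := by
  rw [add_mul, one_mul, map_add, coeff_succ_X_mul, coeff_logDivT, coeff_logDivT]
  have h1 : (k : ℚ) + 1 ≠ 0 := by positivity
  have h2 : (k : ℚ) + 2 ≠ 0 := by positivity
  have h3 : (k : ℚ) + 1 + 1 ≠ 0 := by positivity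
  push_cast
  field_simp
  ring

theorem coeff_X_mul_derivative (f : PowerSeries ℚ) (m : ℕ) :
    coeff m (X * d⁄dX ℚ f) = m * coeff m f := by
  cases m with
  | zero => simp
  | succ m =>
    rw [coeff_succ_X_mul, coeff_derivative]
    push_cast
    ring

theorem coeff_one_inv_logDivT : coeff 1 logDivT⁻¹ = 1 / 2 := by
  have h := congrArg (coeff 1) X_mul_derivative_inv_logDivT
  rw [coeff_mul, Finset.Nat.sum_antidiagonal_eq_sum_range_succ_mk] at h
  simp [-derivative_inv', Finset.sum_range_succ, coeff_X_mul_derivative, constantCoeff_logDivT,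
    coeff_one] at h
  linarith

theorem coeff_inv_logDivT_recurrence (n : ℕ) (hn : 2 ≤ n) :
    ((n : ℚ) + 1) * coeff n logDivT⁻¹ = ∑ m ∈ Finset.Ico 1 n,
      m * coeff m logDivT⁻¹ * ((-1) ^ (n - m) / (((n - m : ℕ) : ℚ) * ((n - m : ℕ) + 1))) := by
  have h := congrArg (coeff n) X_mul_derivative_inv_logDivT
  rw [coeff_mul, Finset.Nat.sum_antidiagonal_eq_sum_range_succ_mk, Finset.sum_range_succ,
    Finset.range_eq_Ico, Finset.sum_eq_sum_Ico_succ_bot (by omega : 0 < n)] at h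
  have hr : coeff n ((1 : PowerSeries ℚ) + X) = 0 := by
    rw [map_add, coeff_one, coeff_X, if_neg (by omega), if_neg (by omega), add_zero]
  have h0 : coeff 0 ((1 + X) * logDivT) = (1 : ℚ) := by simp [constantCoeff_logDivT]
  simp only [coeff_X_mul_derivative, Nat.sub_self, map_sub, hr, h0, Nat.cast_zero, zero_mul,
    zero_add, mul_one, zero_sub] at h
  have hs : ∑ m ∈ Finset.Ico 1 n,
      m * coeff m logDivT⁻¹ * ((-1) ^ (n - m) / (((n - m : ℕ) : ℚ) * ((n - m : ℕ) + 1))) =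
      -∑ m ∈ Finset.Ico 1 n,
        m * coeff m logDivT⁻¹ * coeff (n - m) ((1 + X) * logDivT) := by
    rw [← Finset.sum_neg_distrib]
    refine Finset.sum_congr rfl fun m hm => ?_
    obtain ⟨d, rfl⟩ : ∃ d, n = m + d + 1 := ⟨n - m - 1, by have := Finset.mem_Ico.1 hm; omega⟩
    rw [show m + d + 1 - m = d + 1 by omega, coeff_succ_one_add_X_mul_logDivT]
    push_cast
    ring
  rw [hs]
  linear_combination h

/-! ### The recurrence for the Bernoulli numbers of the second kind -/

theorem bernoulliNumber_eq (n : ℕ) : bernoulliNumber n = n ! * coeff n logDivT⁻¹ := by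
  rw [bernoulliNumber, bernoulliPoly, Polynomial.eval_mul, Polynomial.eval_C]
  congr 1
  have h : PowerSeries.map (Polynomial.evalRingHom (0 : ℚ)) genFun = logDivT⁻¹ := by
    have hb : PowerSeries.map (Polynomial.evalRingHom (0 : ℚ))
        (binomialSeries (Polynomial ℚ) (Polynomial.X : Polynomial ℚ)) = 1 := by
      rw [← binomialSeries_zero (R := ℚ) (A := ℚ)]
      ext k
      rw [PowerSeries.coeff_map, binomialSeries_coeff, binomialSeries_coeff, smul_eq_mul, mul_one,
        smul_eq_mul, mul_one, Ring.map_choose]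
      simp
    rw [genFun, map_mul, hb, one_mul]
    ext k
    simp [PowerSeries.coeff_map]
  rw [← h, PowerSeries.coeff_map]
  rfl

/-- The weight `((n-m-1)!)² binom(n, m+1) binom(n, m-1)` of the step from `m` to `n`. -/
def stepWeight (m n : ℕ) : ℚ :=
  ((n - m - 1)! : ℚ) ^ 2 * (n.choose (m + 1) : ℚ) * (n.choose (m - 1) : ℚ)

/-- The number `(-1)^(n-1) (n+1)! bₙ`. -/
def normalizedNumber (n : ℕ) : ℚ :=
  (-1) ^ (n - 1) * ((n + 1)! : ℚ) * bernoulliNumber n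

theorem normalizedNumber_one : normalizedNumber 1 = 1 := by
  simp [normalizedNumber, bernoulliNumber_eq, coeff_one_inv_logDivT]

theorem stepWeight_mul_factorials {m n : ℕ} (hm : 1 ≤ m) (hmn : m < n) :
    ((m + 1)! : ℚ) * (m ! : ℚ) * stepWeight m n =
      (n ! : ℚ) ^ 2 * m / (((n - m : ℕ) : ℚ) * ((n - m : ℕ) + 1)) := by
  obtain ⟨a, rfl⟩ : ∃ a, m = a + 1 := ⟨m - 1, by omega⟩
  obtain ⟨d, rfl⟩ : ∃ d, n = a + 1 + d + 1 := ⟨n - (a + 1) - 1, by omega⟩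
  rw [stepWeight, Nat.cast_choose ℚ (by omega : a + 1 + 1 ≤ a + 1 + d + 1),
    Nat.cast_choose ℚ (by omega : a + 1 - 1 ≤ a + 1 + d + 1),
    show a + 1 + d + 1 - (a + 1) - 1 = d by omega,
    show a + 1 + d + 1 - (a + 1 + 1) = d by omega, show a + 1 - 1 = a by omega,
    show a + 1 + d + 1 - a = d + 1 + 1 by omega, show a + 1 + d + 1 - (a + 1) = d + 1 by omega]
  have ha : (a ! : ℚ) ≠ 0 := by positivity
  have ha2 : ((a + 1 + 1)! : ℚ) ≠ 0 := by positivity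
  have hd : (d ! : ℚ) ≠ 0 := by positivity
  have hd1 : (d : ℚ) + 1 ≠ 0 := by positivity
  have hd2 : (d : ℚ) + 1 + 1 ≠ 0 := by positivity
  rw [Nat.factorial_succ (d + 1), Nat.factorial_succ d, Nat.factorial_succ a]
  push_cast
  field_simp

theorem normalizedNumber_recurrence (n : ℕ) (hn : 2 ≤ n) :
    normalizedNumber n = ∑ m ∈ Finset.Ico 1 n, normalizedNumber m * stepWeight m n := by
  have h := coeff_inv_logDivT_recurrence n hn
  have hl : normalizedNumber n =
      (-1) ^ (n - 1) * (n ! : ℚ) ^ 2 * (((n : ℚ) + 1) * coeff n logDivT⁻¹) := by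
    rw [normalizedNumber, bernoulliNumber_eq, Nat.factorial_succ]
    push_cast
    ring
  rw [hl, h, Finset.mul_sum]
  refine Finset.sum_congr rfl fun m hm => ?_
  rw [Finset.mem_Ico] at hm
  have hw := stepWeight_mul_factorials hm.1 hm.2
  have hsign : (-1 : ℚ) ^ (n - 1) * (-1) ^ (n - m) = (-1) ^ (m - 1) := by
    rw [← pow_add, show n - 1 + (n - m) = 2 * (n - m) + (m - 1) by omega, pow_add, pow_mul]
    simp
  rw [normalizedNumber, bernoulliNumber_eq, ← hsign]
  linear_combination (-(-1 : ℚ) ^ (n - 1) * (-1) ^ (n - m) * coeff m logDivT⁻¹) * hw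

end BernoulliSecondKind

end

theorem corollary3p4 (n : ℕ) (hn : 2 ≤ n) :
    BernoulliSecondKind.bernoulliNumber n =
      (-1 : ℚ) ^ (n - 1) * (1 / ((n + 1)! : ℚ)) *
        ∑ k ∈ Finset.Icc 0 (n - 2), ∑ i ∈ BernoulliSecondKind.chains n k,
          ∏ j : Fin (k + 1),
            (((i j.succ - i j.castSucc - 1)! : ℚ) ^ 2 *
              ((i j.succ).choose (i j.castSucc + 1) : ℚ) *
              ((i j.succ).choose (i j.castSucc - 1) : ℚ)) := by
  have h := BernoulliSecondKind.sum_chainSum_eq BernoulliSecondKind.normalizedNumber_one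
    BernoulliSecondKind.normalizedNumber_recurrence (n - 1) n hn (by omega)
  have hr : Finset.Icc 0 (n - 2) = Finset.range (n - 1) := by
    ext k
    simp only [Finset.mem_Icc, Finset.mem_range]
    omega
  simp only [BernoulliSecondKind.chainSum, BernoulliSecondKind.stepWeight] at h
  rw [hr, h, BernoulliSecondKind.normalizedNumber]
  have hf : ((n + 1)! : ℚ) ≠ 0 := by positivity
  have hs : (-1 : ℚ) ^ (n - 1) * (-1) ^ (n - 1) = 1 := by
    rw [← mul_pow]
    simp
  field_simp
  linear_combination (-BernoulliSecondKind.bernoulliNumber n) * hs
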